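/- **Theorem 1.4.** Let $dA(z)=\frac{dx\,dy}{\pi}$ denote the normalized area measure on $\mathbb C$ and let $\mathbb D(0,R)=\{z\in\mathbb C:|z|<R\}$. For $R>0$ and a polynomial $f$ with complex coefficients put $$\Psi_f(z,R)=\bigl(|f(z)|e^{-|z|^2}-1_{\mathbb D(0,R)}(z)\bigr)^2,\qquad z\in\mathbb C,$$ and define the planar discrepancy density and the tight planar discrepancy density by $$\rho_{\mathbb C}=\liminf_{R\to\infty}\ \inf_f\ \frac{\int_{\mathbb D(0,R)}\Psi_f(z,R)\,dA(z)}{\int_{\mathbb D(0,R)}dA(z)},\qquad \rho_{\mathbb C}^*=\liminf_{R\to\infty}\ \inf_f\ \frac{\int_{\mathbb C}\Psi_f(z,R)\,dA(z)}{\int_{\mathbb D(0,R)}dA(z)},$$ where both infima are taken over all polynomials $f$ with complex coefficients. Then $\rho_{\mathbb C}=\rho_{\mathbb C}^*$. -/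

import Mathlib

open MeasureTheory Filter
open scoped ENNReal

noncomputable section

/-- The normalized area measure `dA = dx dy / π` on the complex plane. -/
def areaMeasure : Measure ℂ := ENNReal.ofReal Real.pi⁻¹ • (volume : Measure ℂ)

/-- The planar discrepancy function
`Ψ_f(z, R) = (|f(z)| exp(-|z|²) - 1_{D(0,R)}(z))²`. -/
def planarDiscrepancy (f : ℂ → ℂ) (z : ℂ) (R : ℝ) : ℝ :=
  (‖f z‖ * Real.exp (-‖z‖ ^ 2) - (Metric.ball (0 : ℂ) R).indicator (fun _ => (1 : ℝ)) z) ^ 2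

/-- The integral of `Ψ_f(·, R)` over the disk `D(0, R)`, divided by the area of `D(0, R)`.
The integrand is nonnegative and measurable, so the value is taken in `[0, ∞]`. -/
def planarFunctional (R : ℝ) (f : Polynomial ℂ) : ℝ≥0∞ :=
  (∫⁻ z in Metric.ball (0 : ℂ) R,
      ENNReal.ofReal (planarDiscrepancy (fun w => f.eval w) z R) ∂areaMeasure) /
    areaMeasure (Metric.ball (0 : ℂ) R)

/-- The integral of `Ψ_f(·, R)` over the whole plane, divided by the area of `D(0, R)`. -/
def tightPlanarFunctional (R : ℝ) (f : Polynomial ℂ) : ℝ≥0∞ :=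
  (∫⁻ z : ℂ, ENNReal.ofReal (planarDiscrepancy (fun w => f.eval w) z R) ∂areaMeasure) /
    areaMeasure (Metric.ball (0 : ℂ) R)

/-- The planar discrepancy density `ρ_ℂ`; the infimum runs over all complex polynomials. -/
def planarDensity : ℝ≥0∞ :=
  liminf (fun R : ℝ => ⨅ f : Polynomial ℂ, planarFunctional R f) atTop

/-- The tight planar discrepancy density `ρ_ℂ*`. -/
def tightPlanarDensity : ℝ≥0∞ :=
  liminf (fun R : ℝ => ⨅ f : Polynomial ℂ, tightPlanarFunctional R f) atTop

lemma planarFunctional_le_tight (R : ℝ) (f : Polynomial ℂ) :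
    planarFunctional R f ≤ tightPlanarFunctional R f := by
  unfold planarFunctional tightPlanarFunctional
  gcongr
  exact Measure.restrict_le_self

lemma tightPlanarFunctional_zero_le_one (R : ℝ) : tightPlanarFunctional R 0 ≤ 1 := by
  have h : ∀ z : ℂ, ENNReal.ofReal
      (planarDiscrepancy (fun w => (0 : Polynomial ℂ).eval w) z R) =
      (Metric.ball (0 : ℂ) R).indicator 1 z := by
    intro z
    by_cases hz : z ∈ Metric.ball (0 : ℂ) R <;>
      simp only [planarDiscrepancy, Set.indicator_of_mem, Set.indicator_of_notMem, hz,
        not_false_eq_true] <;> simp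
  unfold tightPlanarFunctional
  simp_rw [h]
  rw [lintegral_indicator_one Metric.isOpen_ball.measurableSet]
  exact ENNReal.div_self_le_one

/-- The tight density is finite: it is at most `1`. -/
lemma tightPlanarDensity_le_one : tightPlanarDensity ≤ 1 := by
  unfold tightPlanarDensity
  calc liminf (fun R : ℝ => ⨅ f : Polynomial ℂ, tightPlanarFunctional R f) atTop
      ≤ liminf (fun _ : ℝ => (1 : ℝ≥0∞)) atTop :=
        liminf_le_liminf (Eventually.of_forall fun R =>
          (iInf_le _ 0).trans (tightPlanarFunctional_zero_le_one R))
    _ = 1 := liminf_const 1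

/-- The trivial inequality between the densities; in particular both are finite. -/
lemma planarDensity_le_tight : planarDensity ≤ tightPlanarDensity :=
  liminf_le_liminf (Eventually.of_forall fun R =>
    iInf_mono fun f => planarFunctional_le_tight R f)

end

/-! Only ρ* ≤ ρ needs work: a polynomial `f` that does well on the disk must be replaced by one that
does almost as well there and is small outside. The replacement `F` is a truncation of `f`. In the
variable s = |z|², the monomial zⁿ has mass density proportional to sⁿ exp(-2s), which peaks at s =
n/2. Cutting `f` at degree 2t therefore keeps the monomials peaking inside |z|² ≤ t and discards
those peaking outside. The kept ones decay beyond t and the discarded ones decay below t, so both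
errors are controlled by the mass in a window of half-width w around t
(`setLIntegral_Ici_le_mul_Ico`, `setLIntegral_Ioo_le_mul_Ico`). Monomials are orthogonal over
rotation invariant sets (`setLIntegral_norm_sq_mul_exp`), so these estimates add up to one for `f`
itself (`exists_polynomial_approx_restrict`).

It remains to choose t just below R² so that `f` has little mass in the window. If the discrepancy
on the disk is at most its area, the mass of `f` there is O(R²), and pigeonholing over many thin
annuli gives such a t (`exists_annulus_setLIntegral_le`). The total loss relative to the area is
O(1/k), for arbitrary k and all large R (`exists_tightPlanarFunctional_le`). -/

/-! ### Tails of the radial weights -/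

lemma hasDerivAt_pow_mul_exp_neg (n : ℕ) (t : ℝ) :
    HasDerivAt (fun s : ℝ => s ^ n * Real.exp (-(2 * s)))
      ((n * t ^ (n - 1) - 2 * t ^ n) * Real.exp (-(2 * t))) t := by
  have h1 : HasDerivAt (fun s : ℝ => -(2 * s)) (-(2 * 1)) t := ((hasDerivAt_id t).const_mul 2).neg
  exact ((hasDerivAt_pow n t).mul h1.exp).congr_deriv (by ring)

lemma tendsto_pow_mul_exp_neg_two_mul (n : ℕ) :
    Tendsto (fun s : ℝ => s ^ n * Real.exp (-(2 * s))) atTop (nhds 0) := by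
  have h := ((Real.tendsto_pow_mul_exp_neg_atTop_nhds_zero n).comp
    (tendsto_id.const_mul_atTop (zero_lt_two (α := ℝ)))).const_mul ((2 ^ n)⁻¹ : ℝ)
  rw [mul_zero] at h
  refine h.congr fun s => ?_
  simp only [Function.comp, id, mul_pow]
  field_simp

/-- `t ^ n * exp (-2 t)` increases up to `n / 2`. -/
lemma pow_mul_exp_neg_mono {n : ℕ} {a b : ℝ} (ha : 0 ≤ a) (hab : a ≤ b) (hb : 2 * b ≤ n) :
    a ^ n * Real.exp (-(2 * a)) ≤ b ^ n * Real.exp (-(2 * b)) := by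
  have hm : MonotoneOn (fun s : ℝ => s ^ n * Real.exp (-(2 * s))) (Set.Icc a b) := by
    refine monotoneOn_of_deriv_nonneg (convex_Icc a b) ?_ ?_ ?_
    · exact (by fun_prop : Continuous _).continuousOn
    · intro x _
      exact (hasDerivAt_pow_mul_exp_neg n x).differentiableAt.differentiableWithinAt
    · intro x hx
      rw [interior_Icc] at hx
      rw [(hasDerivAt_pow_mul_exp_neg n x).deriv]
      have hx0 : 0 < x := ha.trans_lt hx.1
      refine mul_nonneg ?_ (Real.exp_nonneg _)
      rcases n with _ | n
      · exfalso
        push_cast at hb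
        linarith [hx.2]
      · simp only [Nat.add_sub_cancel]
        have : (((n + 1 : ℕ) : ℝ) * x ^ n - 2 * x ^ (n + 1)) = x ^ n * (((n + 1 : ℕ) : ℝ) - 2 * x) := by
          ring
        rw [this]
        exact mul_nonneg (by positivity) (by linarith [hx.2])
  exact hm (Set.left_mem_Icc.2 hab) (Set.right_mem_Icc.2 hab) hab

/-- `t ^ n * exp (-2 t)` decreases from `n / 2` on. -/
lemma pow_mul_exp_neg_anti {n : ℕ} {a b : ℝ} (ha : 0 < a) (hab : a ≤ b) (hn : n ≤ 2 * a) :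
    b ^ n * Real.exp (-(2 * b)) ≤ a ^ n * Real.exp (-(2 * a)) := by
  have hm : AntitoneOn (fun s : ℝ => s ^ n * Real.exp (-(2 * s))) (Set.Icc a b) := by
    refine antitoneOn_of_deriv_nonpos (convex_Icc a b) ?_ ?_ ?_
    · exact (by fun_prop : Continuous _).continuousOn
    · intro x _
      exact (hasDerivAt_pow_mul_exp_neg n x).differentiableAt.differentiableWithinAt
    · intro x hx
      rw [interior_Icc] at hx
      rw [(hasDerivAt_pow_mul_exp_neg n x).deriv]
      have hx0 : 0 < x := ha.trans hx.1
      refine mul_nonpos_of_nonpos_of_nonneg ?_ (Real.exp_nonneg _)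
      rcases n with _ | n
      · simp
      · simp only [Nat.add_sub_cancel]
        have : (((n + 1 : ℕ) : ℝ) * x ^ n - 2 * x ^ (n + 1)) = x ^ n * (((n + 1 : ℕ) : ℝ) - 2 * x) := by
          ring
        rw [this]
        exact mul_nonpos_of_nonneg_of_nonpos (by positivity) (by linarith [hx.1])
  exact hm (Set.left_mem_Icc.2 hab) (Set.right_mem_Icc.2 hab) hab

/-- For s ≤ t - w one has n - 2s ≥ 2w, so the integrand is at most t / (2w) times its own
derivative, which integrates exactly. -/
lemma setLIntegral_Ioo_pow_mul_exp_neg_le {n : ℕ} {t w : ℝ} (hw : 0 < w) (hwt : w ≤ t)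
    (hn : 2 * t ≤ n) :
    ∫⁻ s in Set.Ioo 0 (t - w), ENNReal.ofReal (s ^ n * Real.exp (-(2 * s))) ≤
      ENNReal.ofReal (t / (2 * w) * ((t - w) ^ n * Real.exp (-(2 * (t - w))))) := by
  have ht : 0 < t := hw.trans_le hwt
  have hb : 0 ≤ t - w := by linarith
  -- Since n ≥ 2t > 0, the exponent n - 1 in the derivative is a genuine predecessor.
  obtain ⟨m, rfl⟩ : ∃ m, n = m + 1 := ⟨n - 1, by
    have : 0 < n := by
      rcases Nat.eq_zero_or_pos n with h | h
      · subst h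
        push_cast at hn
        linarith
      · exact h
    omega⟩
  have hc : Continuous (fun s : ℝ => t / (2 * w) *
      ((((m + 1 : ℕ) : ℝ) * s ^ (m + 1 - 1) - 2 * s ^ (m + 1)) * Real.exp (-(2 * s)))) := by
    fun_prop
  have key : ∀ s : ℝ, 0 < s → s ≤ t - w → s ^ (m + 1) * Real.exp (-(2 * s)) ≤ t / (2 * w) *
      ((((m + 1 : ℕ) : ℝ) * s ^ (m + 1 - 1) - 2 * s ^ (m + 1)) * Real.exp (-(2 * s))) := by
    intro s hs hst
    rw [← mul_assoc]
    refine mul_le_mul_of_nonneg_right ?_ (Real.exp_nonneg _)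
    rw [div_mul_eq_mul_div, le_div_iff₀ (by positivity)]
    have e1 : s ^ (m + 1) * (2 * w) = s ^ m * (s * (2 * w)) := by ring
    have e2 : t * (((m + 1 : ℕ) : ℝ) * s ^ (m + 1 - 1) - 2 * s ^ (m + 1)) =
        s ^ m * (t * (((m + 1 : ℕ) : ℝ) - 2 * s)) := by
      simp only [Nat.add_sub_cancel]
      ring
    rw [e1, e2]
    refine mul_le_mul_of_nonneg_left ?_ (by positivity)
    exact mul_le_mul (by linarith) (by linarith) (by linarith) ht.le
  calc ∫⁻ s in Set.Ioo 0 (t - w), ENNReal.ofReal (s ^ (m + 1) * Real.exp (-(2 * s)))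
      ≤ ∫⁻ s in Set.Ioc 0 (t - w), ENNReal.ofReal (t / (2 * w) *
      ((((m + 1 : ℕ) : ℝ) * s ^ (m + 1 - 1) - 2 * s ^ (m + 1)) * Real.exp (-(2 * s)))) := by
        refine (lintegral_mono_set Set.Ioo_subset_Ioc_self).trans ?_
        exact setLIntegral_mono' measurableSet_Ioc fun s hs =>
          ENNReal.ofReal_le_ofReal (key s hs.1 hs.2)
    _ = ENNReal.ofReal (∫ s in (0 : ℝ)..(t - w), t / (2 * w) *
      ((((m + 1 : ℕ) : ℝ) * s ^ (m + 1 - 1) - 2 * s ^ (m + 1)) * Real.exp (-(2 * s)))) := by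
        rw [intervalIntegral.integral_of_le hb, ofReal_integral_eq_lintegral_ofReal]
        · exact (hc.integrableOn_Icc).mono_set Set.Ioc_subset_Icc_self
        · filter_upwards [ae_restrict_mem measurableSet_Ioc] with s hs
          have hs0 := hs.1
          exact le_trans (by positivity) (key s hs.1 hs.2)
    _ = _ := by
        rw [intervalIntegral.integral_const_mul,
          intervalIntegral.integral_eq_sub_of_hasDerivAt
            (fun x _ => hasDerivAt_pow_mul_exp_neg (m + 1) x)
            ((by fun_prop : Continuous _).intervalIntegrable _ _)]
        simp

/-- Mirror image of the bound left of the peak: beyond t + w the integrand is dominated by a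
multiple of minus its derivative, and the boundary term at infinity vanishes. -/
lemma setLIntegral_Ici_pow_mul_exp_neg_le {n : ℕ} {t w : ℝ} (hw : 0 < w) (ht : 0 < t)
    (hn : n ≤ 2 * t) :
    ∫⁻ s in Set.Ici (t + w), ENNReal.ofReal (s ^ n * Real.exp (-(2 * s))) ≤
      ENNReal.ofReal ((t + w) / (2 * w) * ((t + w) ^ n * Real.exp (-(2 * (t + w))))) := by
  have key : ∀ s : ℝ, t + w < s → s ^ n * Real.exp (-(2 * s)) ≤ (t + w) / (2 * w) *
      -((n * s ^ (n - 1) - 2 * s ^ n) * Real.exp (-(2 * s))) := by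
    intro s hs
    have hs0 : 0 < s := by linarith
    rw [← neg_mul (n * s ^ (n - 1) - 2 * s ^ n), ← mul_assoc]
    refine mul_le_mul_of_nonneg_right ?_ (Real.exp_nonneg _)
    rw [div_mul_eq_mul_div, le_div_iff₀ (by positivity)]
    -- The difference of the two sides is t (s - t - w).
    have h0 : w * s ≤ (t + w) * (s - t) := by nlinarith
    rcases n with _ | m
    · simp
      nlinarith
    · have e1 : s ^ (m + 1) * (2 * w) = s ^ m * (2 * (w * s)) := by ring
      have e2 : (t + w) * -(((m + 1 : ℕ) : ℝ) * s ^ (m + 1 - 1) - 2 * s ^ (m + 1)) =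
          s ^ m * ((t + w) * (2 * s - ((m + 1 : ℕ) : ℝ))) := by
        simp only [Nat.add_sub_cancel]
        ring
      rw [e1, e2]
      refine mul_le_mul_of_nonneg_left ?_ (by positivity)
      calc 2 * (w * s) ≤ (t + w) * (2 * (s - t)) := by linarith
        _ ≤ _ := mul_le_mul_of_nonneg_left (by linarith) (by linarith)
  have hcont : ContinuousWithinAt (fun s : ℝ => s ^ n * Real.exp (-(2 * s)))
      (Set.Ici (t + w)) (t + w) := (by fun_prop : Continuous _).continuousWithinAt
  -- The sign of the derivative is read off from `key`; it gives integrability on the half-line.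
  have hneg : ∀ s ∈ Set.Ioi (t + w),
      (n * s ^ (n - 1) - 2 * s ^ n) * Real.exp (-(2 * s)) ≤ 0 := by
    intro s hs
    have hs' : t + w < s := hs
    have hs0 : 0 < s := by linarith
    have h1 := (show (0 : ℝ) ≤ s ^ n * Real.exp (-(2 * s)) by positivity).trans (key s hs)
    have h2 : 0 < (t + w) / (2 * w) := by positivity
    have := nonneg_of_mul_nonneg_right h1 h2
    linarith
  calc ∫⁻ s in Set.Ici (t + w), ENNReal.ofReal (s ^ n * Real.exp (-(2 * s)))
      = ∫⁻ s in Set.Ioi (t + w), ENNReal.ofReal (s ^ n * Real.exp (-(2 * s))) :=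
        setLIntegral_congr Ioi_ae_eq_Ici.symm
    _ ≤ ∫⁻ s in Set.Ioi (t + w), ENNReal.ofReal ((t + w) / (2 * w) *
      -((n * s ^ (n - 1) - 2 * s ^ n) * Real.exp (-(2 * s)))) :=
        setLIntegral_mono' measurableSet_Ioi fun s hs => ENNReal.ofReal_le_ofReal (key s hs)
    _ = ENNReal.ofReal (∫ s in Set.Ioi (t + w), (t + w) / (2 * w) *
      -((n * s ^ (n - 1) - 2 * s ^ n) * Real.exp (-(2 * s)))) := by
        rw [ofReal_integral_eq_lintegral_ofReal]
        · exact ((integrableOn_Ioi_deriv_of_nonpos hcont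
            (fun x _ => hasDerivAt_pow_mul_exp_neg n x) hneg
            (tendsto_pow_mul_exp_neg_two_mul n)).neg).const_mul _
        · filter_upwards [ae_restrict_mem measurableSet_Ioi] with s hs
          have hs' : t + w < s := hs
          have hs0 : 0 < s := by linarith
          exact le_trans (by positivity) (key s hs)
    _ = _ := by
        rw [integral_const_mul, integral_neg, integral_Ioi_of_hasDerivAt_of_nonpos hcont
            (fun x _ => hasDerivAt_pow_mul_exp_neg n x) hneg
            (tendsto_pow_mul_exp_neg_two_mul n)]
        simp

/-- Left of the peak, the mass of `t ^ n * exp (-2 t)` on `(0, t)` is controlled by its mass near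
`t`. -/
lemma setLIntegral_Ioo_le_mul_Ico {n : ℕ} {t w : ℝ} (hw : 0 < w) (hwt : w ≤ t)
    (hn : 2 * t ≤ n) :
    ∫⁻ s in Set.Ioo 0 t, ENNReal.ofReal (s ^ n * Real.exp (-(2 * s))) ≤
      ENNReal.ofReal (1 + t / (2 * w ^ 2)) *
        ∫⁻ s in Set.Ico (t - w) t, ENNReal.ofReal (s ^ n * Real.exp (-(2 * s))) := by
  have ht : 0 < t := hw.trans_le hwt
  rw [ENNReal.ofReal_add zero_le_one (by positivity), ENNReal.ofReal_one, add_mul, one_mul,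
    add_comm]
  have hsub : Set.Ioo 0 t ⊆ Set.Ioo 0 (t - w) ∪ Set.Ico (t - w) t := by
    intro s hs
    rcases lt_or_ge s (t - w) with h | h
    · exact Or.inl ⟨hs.1, h⟩
    · exact Or.inr ⟨h, hs.2⟩
  refine (lintegral_mono_set hsub).trans ((lintegral_union_le _ _ _).trans ?_)
  gcongr
  refine (setLIntegral_Ioo_pow_mul_exp_neg_le hw hwt hn).trans ?_
  -- A factor w is split off: the rectangle of width w and height the value at t - w lies under the
  -- graph on [t - w, t), where the weight increases.
  have e : t / (2 * w) * ((t - w) ^ n * Real.exp (-(2 * (t - w)))) =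
      t / (2 * w ^ 2) * (((t - w) ^ n * Real.exp (-(2 * (t - w)))) * w) := by
    field_simp
  have hb : 0 ≤ t - w := by linarith
  rw [e, ENNReal.ofReal_mul (by positivity)]
  gcongr
  calc ENNReal.ofReal (((t - w) ^ n * Real.exp (-(2 * (t - w)))) * w)
      = ∫⁻ s in Set.Ico (t - w) t, ENNReal.ofReal ((t - w) ^ n * Real.exp (-(2 * (t - w)))) := by
        rw [setLIntegral_const, Real.volume_Ico, ENNReal.ofReal_mul (by positivity)]
        congr 2
        ring
    _ ≤ _ := setLIntegral_mono' measurableSet_Ico fun s hs => ENNReal.ofReal_le_ofReal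
        (pow_mul_exp_neg_mono hb hs.1 (by linarith [hs.2]))

/-- Right of the peak, the mass of `t ^ n * exp (-2 t)` on `[t, ∞)` is controlled by its mass near
`t`. -/
lemma setLIntegral_Ici_le_mul_Ico {n : ℕ} {t w : ℝ} (hw : 0 < w) (ht : 0 < t)
    (hn : n ≤ 2 * t) :
    ∫⁻ s in Set.Ici t, ENNReal.ofReal (s ^ n * Real.exp (-(2 * s))) ≤
      ENNReal.ofReal (1 + (t + w) / (2 * w ^ 2)) *
        ∫⁻ s in Set.Ico t (t + w), ENNReal.ofReal (s ^ n * Real.exp (-(2 * s))) := by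
  rw [ENNReal.ofReal_add zero_le_one (by positivity), ENNReal.ofReal_one, add_mul, one_mul]
  have hsub : Set.Ici t ⊆ Set.Ico t (t + w) ∪ Set.Ici (t + w) := by
    intro s hs
    rcases lt_or_ge s (t + w) with h | h
    · exact Or.inl ⟨hs, h⟩
    · exact Or.inr h
  refine (lintegral_mono_set hsub).trans ((lintegral_union_le _ _ _).trans ?_)
  gcongr
  refine (setLIntegral_Ici_pow_mul_exp_neg_le hw ht hn).trans ?_
  have e : (t + w) / (2 * w) * ((t + w) ^ n * Real.exp (-(2 * (t + w)))) =
      (t + w) / (2 * w ^ 2) * (((t + w) ^ n * Real.exp (-(2 * (t + w)))) * w) := by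
    field_simp
  rw [e, ENNReal.ofReal_mul (by positivity)]
  gcongr
  calc ENNReal.ofReal (((t + w) ^ n * Real.exp (-(2 * (t + w)))) * w)
      = ∫⁻ s in Set.Ico t (t + w), ENNReal.ofReal ((t + w) ^ n * Real.exp (-(2 * (t + w)))) := by
        rw [setLIntegral_const, Real.volume_Ico, ENNReal.ofReal_mul (by positivity)]
        congr 2
        ring
    _ ≤ _ := setLIntegral_mono' measurableSet_Ico fun s hs => ENNReal.ofReal_le_ofReal
        (pow_mul_exp_neg_anti (ht.trans_le hs.1) hs.2.le (by linarith [hs.1]))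

/-! ### Orthogonality of monomials -/

lemma integral_exp_int_mul_I {k : ℤ} (hk : k ≠ 0) :
    ∫ θ in (-Real.pi)..Real.pi, Complex.exp (k * Complex.I * θ) = 0 := by
  rw [integral_exp_mul_complex (by simp [hk])]
  have h : Complex.exp (k * Complex.I * (Real.pi : ℝ)) =
      Complex.exp (k * Complex.I * ((-Real.pi : ℝ) : ℂ)) := by
    rw [Complex.exp_eq_exp_iff_exists_int]
    exact ⟨k, by push_cast; ring⟩
  rw [h, sub_self, zero_div]

/-- Parseval's identity for trigonometric polynomials. -/
lemma integral_norm_sq_trigonometric (M : ℕ) (c : ℕ → ℂ) :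
    ∫ θ in (-Real.pi)..Real.pi,
        ‖∑ n ∈ Finset.range M, c n * Complex.exp (θ * Complex.I) ^ n‖ ^ 2 =
      2 * Real.pi * ∑ n ∈ Finset.range M, ‖c n‖ ^ 2 := by
  have h : ∀ θ : ℝ, ((‖∑ n ∈ Finset.range M, c n * Complex.exp (θ * Complex.I) ^ n‖ ^ 2 : ℝ) : ℂ) =
      ∑ n ∈ Finset.range M, ∑ m ∈ Finset.range M, c n * (starRingEnd ℂ) (c m) *
        Complex.exp (((n : ℤ) - (m : ℤ) : ℤ) * Complex.I * θ) := by
    intro θ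
    rw [Complex.ofReal_pow, ← Complex.mul_conj', map_sum, Finset.sum_mul_sum]
    refine Finset.sum_congr rfl fun n _ => Finset.sum_congr rfl fun m _ => ?_
    rw [map_mul, map_pow, ← Complex.exp_conj, ← Complex.exp_nat_mul, ← Complex.exp_nat_mul,
      mul_mul_mul_comm, ← Complex.exp_add]
    congr 2
    simp
    ring
  apply Complex.ofReal_injective
  rw [← intervalIntegral.integral_ofReal]
  simp_rw [h]
  rw [intervalIntegral.integral_finsetSum
    fun n _ => (by fun_prop : Continuous _).intervalIntegrable _ _]
  push_cast
  rw [Finset.mul_sum]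
  refine Finset.sum_congr rfl fun n hn => ?_
  rw [intervalIntegral.integral_finsetSum
    fun n _ => (by fun_prop : Continuous _).intervalIntegrable _ _]
  rw [Finset.sum_eq_single_of_mem n hn]
  · simp [Complex.mul_conj']
    left
    ring
  · intro m _ hm
    have hnm : (n : ℤ) - (m : ℤ) ≠ 0 := sub_ne_zero.2 (by exact_mod_cast hm.symm)
    have h0 := integral_exp_int_mul_I hnm
    push_cast at h0
    rw [intervalIntegral.integral_const_mul, h0, mul_zero]

lemma lintegral_norm_sq_trigonometric (M : ℕ) (c : ℕ → ℂ) :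
    ∫⁻ θ in Set.Ioo (-Real.pi) Real.pi,
        ENNReal.ofReal (‖∑ n ∈ Finset.range M, c n * Complex.exp (θ * Complex.I) ^ n‖ ^ 2) =
      ENNReal.ofReal (2 * Real.pi * ∑ n ∈ Finset.range M, ‖c n‖ ^ 2) := by
  have hc : Continuous fun θ : ℝ =>
      ‖∑ n ∈ Finset.range M, c n * Complex.exp (θ * Complex.I) ^ n‖ ^ 2 := by fun_prop
  rw [← integral_norm_sq_trigonometric, intervalIntegral.integral_of_le (by linarith [Real.pi_pos]),
    integral_Ioc_eq_integral_Ioo, ofReal_integral_eq_lintegral_ofReal]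
  · exact hc.integrableOn_Icc.mono_set Set.Ioo_subset_Icc_self
  · exact Eventually.of_forall fun θ => by positivity

/-- The substitution t = r² absorbs the polar Jacobian and turns radial integrals into integrals of
tⁿ exp(-2t). -/
lemma lintegral_Ioi_comp_sq (u : ℝ → ℝ≥0∞) :
    ∫⁻ r in Set.Ioi (0 : ℝ), ENNReal.ofReal (2 * r) * u (r ^ 2) = ∫⁻ t in Set.Ioi (0 : ℝ), u t := by
  have himg : (fun r : ℝ => r ^ 2) '' Set.Ioi 0 = Set.Ioi 0 := by
    ext t
    constructor
    · rintro ⟨r, hr, rfl⟩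
      exact pow_pos (Set.mem_Ioi.1 hr) 2
    · intro ht
      exact ⟨Real.sqrt t, Real.sqrt_pos.2 ht, Real.sq_sqrt (le_of_lt ht)⟩
  have h := lintegral_image_eq_lintegral_deriv_mul_of_monotoneOn (s := Set.Ioi (0 : ℝ))
    (f := fun r => r ^ 2) (f' := fun r => 2 * r) measurableSet_Ioi
    (fun x _ => by simpa using (hasDerivAt_pow 2 x).hasDerivWithinAt)
    (fun x hx y _ hxy => pow_le_pow_left₀ (le_of_lt hx) hxy 2) u
  rw [himg] at h
  exact h.symm

/-- Monomials are orthogonal in the Fock space over any rotation invariant set. -/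
lemma setLIntegral_norm_sq_mul_exp (M : ℕ) (a : ℕ → ℂ) {S : Set ℝ} (hS : MeasurableSet S) :
    ∫⁻ z in {z : ℂ | ‖z‖ ^ 2 ∈ S}, ENNReal.ofReal
        (‖∑ n ∈ Finset.range M, a n * z ^ n‖ ^ 2 * Real.exp (-(2 * ‖z‖ ^ 2))) =
      ∑ n ∈ Finset.range M, ENNReal.ofReal (Real.pi * ‖a n‖ ^ 2) *
        ∫⁻ t in Set.Ioi 0 ∩ S, ENNReal.ofReal (t ^ n * Real.exp (-(2 * t))) := by
  have hm : MeasurableSet {z : ℂ | ‖z‖ ^ 2 ∈ S} :=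
    (by fun_prop : Measurable fun z : ℂ => ‖z‖ ^ 2) hS
  have hmS : Measurable (S.indicator (1 : ℝ → ℝ≥0∞)) := measurable_one.indicator hS
  have h1 : ∀ z : ℂ, ({z : ℂ | ‖z‖ ^ 2 ∈ S}.indicator fun z => ENNReal.ofReal
        (‖∑ n ∈ Finset.range M, a n * z ^ n‖ ^ 2 * Real.exp (-(2 * ‖z‖ ^ 2)))) z =
      S.indicator 1 (‖z‖ ^ 2) * ENNReal.ofReal
        (‖∑ n ∈ Finset.range M, a n * z ^ n‖ ^ 2 * Real.exp (-(2 * ‖z‖ ^ 2))) := by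
    intro z
    by_cases hz : ‖z‖ ^ 2 ∈ S <;> simp [Set.indicator, hz]
  rw [← lintegral_indicator hm]
  simp_rw [h1]
  rw [← Complex.lintegral_comp_polarCoord_symm, polarCoord_target, Measure.volume_eq_prod,
    setLIntegral_prod]
  swap
  · refine Measurable.aemeasurable ?_
    simp_rw [Complex.polarCoord_symm_apply]
    have : Measurable fun p : ℝ × ℝ =>
        (‖(p.1 : ℂ) * (Real.cos p.2 + Real.sin p.2 * Complex.I)‖ ^ 2) := by fun_prop
    exact (by fun_prop : Measurable fun p : ℝ × ℝ => ENNReal.ofReal p.1).smul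
      ((hmS.comp this).mul (by fun_prop))
  -- The indicator is constant on circles. Parseval gives a factor 2π, regrouped with the Jacobian r
  -- as π · 2r for the substitution t = r².
  calc _ = ∫⁻ r in Set.Ioi (0 : ℝ), ENNReal.ofReal (2 * r) * ∑ n ∈ Finset.range M,
        ENNReal.ofReal (Real.pi * ‖a n‖ ^ 2) * (S.indicator
          (fun t => ENNReal.ofReal (t ^ n * Real.exp (-(2 * t)))) (r ^ 2)) := by
        refine setLIntegral_congr_fun measurableSet_Ioi fun r hr => ?_
        have hr0 : 0 < r := hr
        have h2 : ∀ θ : ℝ, ENNReal.ofReal r • (S.indicator 1 (‖Complex.polarCoord.symm (r, θ)‖ ^ 2) *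
            ENNReal.ofReal (‖∑ n ∈ Finset.range M, a n * Complex.polarCoord.symm (r, θ) ^ n‖ ^ 2 *
              Real.exp (-(2 * ‖Complex.polarCoord.symm (r, θ)‖ ^ 2)))) =
            (ENNReal.ofReal r * S.indicator 1 (r ^ 2) * ENNReal.ofReal (Real.exp (-(2 * r ^ 2)))) *
            ENNReal.ofReal (‖∑ n ∈ Finset.range M, (a n * r ^ n) *
              Complex.exp (θ * Complex.I) ^ n‖ ^ 2) := by
          intro θ
          have e : Complex.polarCoord.symm (r, θ) = r * Complex.exp (θ * Complex.I) := by
            rw [Complex.polarCoord_symm_apply, Complex.exp_mul_I]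
            push_cast
            rfl
          have e2 : ‖(r : ℂ) * Complex.exp (θ * Complex.I)‖ = r := by
            rw [norm_mul, Complex.norm_exp_ofReal_mul_I, mul_one, Complex.norm_of_nonneg hr0.le]
          rw [e, e2, ENNReal.ofReal_mul (by positivity)]
          simp_rw [mul_pow, ← mul_assoc, smul_eq_mul]
          ring
        simp only [h2]
        rw [lintegral_const_mul _ (by fun_prop), lintegral_norm_sq_trigonometric]
        by_cases hrS : r ^ 2 ∈ S
        · simp only [Set.indicator_of_mem hrS, Pi.one_apply, mul_one]
          rw [← ENNReal.ofReal_mul hr0.le, ← ENNReal.ofReal_mul (by positivity)]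
          simp_rw [← ENNReal.ofReal_mul (show (0 : ℝ) ≤ Real.pi * ‖a _‖ ^ 2 by positivity)]
          rw [← ENNReal.ofReal_sum_of_nonneg (fun n _ => by positivity),
            ← ENNReal.ofReal_mul (by positivity)]
          congr 1
          simp_rw [Finset.mul_sum]
          refine Finset.sum_congr rfl fun n _ => ?_
          rw [norm_mul, norm_pow, Complex.norm_of_nonneg hr0.le]
          ring
        · simp [Set.indicator_of_notMem hrS]
    _ = _ := by
        rw [lintegral_Ioi_comp_sq (fun t => ∑ n ∈ Finset.range M,
          ENNReal.ofReal (Real.pi * ‖a n‖ ^ 2) * (S.indicator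
          (fun t => ENNReal.ofReal (t ^ n * Real.exp (-(2 * t)))) t))]
        rw [lintegral_finsetSum _ fun n _ => Measurable.const_mul
          ((by fun_prop : Measurable _).indicator hS) _]
        refine Finset.sum_congr rfl fun n _ => ?_
        rw [lintegral_const_mul _ ((by fun_prop : Measurable _).indicator hS),
          setLIntegral_indicator hS, Set.inter_comm]

/-! ### Truncation in the Fock space -/

lemma measurableSet_norm_sq_mem {S : Set ℝ} (hS : MeasurableSet S) :
    MeasurableSet {z : ℂ | ‖z‖ ^ 2 ∈ S} :=
  (by fun_prop : Measurable fun z : ℂ => ‖z‖ ^ 2) hS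

/-- Truncating a polynomial at degree `2 t` approximates, in the Fock space norm, its restriction
to the disk `‖z‖ ^ 2 < t` up to its mass near the boundary of that disk. -/
lemma exists_polynomial_approx_restrict (f : Polynomial ℂ) {t w : ℝ} (hw : 0 < w) (hwt : w < t) :
    ∃ F : Polynomial ℂ,
      (∫⁻ z in {z : ℂ | ‖z‖ ^ 2 ∈ Set.Iio t},
          ENNReal.ofReal (‖f.eval z - F.eval z‖ ^ 2 * Real.exp (-(2 * ‖z‖ ^ 2)))) +
        ∫⁻ z in {z : ℂ | ‖z‖ ^ 2 ∈ Set.Ici t},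
          ENNReal.ofReal (‖F.eval z‖ ^ 2 * Real.exp (-(2 * ‖z‖ ^ 2))) ≤
      ENNReal.ofReal (1 + (t + w) / (2 * w ^ 2)) *
        ∫⁻ z in {z : ℂ | ‖z‖ ^ 2 ∈ Set.Ico (t - w) (t + w)},
          ENNReal.ofReal (‖f.eval z‖ ^ 2 * Real.exp (-(2 * ‖z‖ ^ 2))) := by
  have ht : 0 < t := hw.trans hwt
  set M := f.natDegree + 1
  -- The condition n ≤ 2t says that the peak n/2 of the weight lies at or before t.
  let low : ℕ → ℂ := fun n => if (n : ℝ) ≤ 2 * t then f.coeff n else 0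
  let high : ℕ → ℂ := fun n => if (n : ℝ) ≤ 2 * t then 0 else f.coeff n
  have hf : ∀ z, f.eval z = ∑ n ∈ Finset.range M, f.coeff n * z ^ n :=
    fun z => Polynomial.eval_eq_sum_range z
  refine ⟨∑ n ∈ Finset.range M, Polynomial.C (low n) * Polynomial.X ^ n, ?_⟩
  have hF : ∀ z, (∑ n ∈ Finset.range M, Polynomial.C (low n) * Polynomial.X ^ n).eval z =
      ∑ n ∈ Finset.range M, low n * z ^ n := by
    intro z
    simp [Polynomial.eval_finsetSum]
  have hd : ∀ z, f.eval z - (∑ n ∈ Finset.range M, Polynomial.C (low n) * Polynomial.X ^ n).eval z =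
      ∑ n ∈ Finset.range M, high n * z ^ n := by
    intro z
    rw [hF, hf, ← Finset.sum_sub_distrib]
    refine Finset.sum_congr rfl fun n _ => ?_
    by_cases h : (n : ℝ) ≤ 2 * t <;> simp [low, high, h]
  simp_rw [hd, hF, hf]
  rw [setLIntegral_norm_sq_mul_exp M high (S := Set.Iio t) measurableSet_Iio,
    setLIntegral_norm_sq_mul_exp M low (S := Set.Ici t) measurableSet_Ici,
    setLIntegral_norm_sq_mul_exp M f.coeff (S := Set.Ico (t - w) (t + w)) measurableSet_Ico, ← Finset.sum_add_distrib,
    Finset.mul_sum]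
  -- For each n one of `low n`, `high n` vanishes, so only one tail estimate is needed per monomial.
  refine Finset.sum_le_sum fun n _ => ?_
  rw [mul_left_comm]
  by_cases h : (n : ℝ) ≤ 2 * t
  · simp only [low, high, h, if_true, norm_zero]
    simp only [ne_eq, OfNat.ofNat_ne_zero, not_false_eq_true, zero_pow, mul_zero,
      ENNReal.ofReal_zero, zero_mul, zero_add]
    gcongr
    refine (lintegral_mono_set Set.inter_subset_right).trans
      ((setLIntegral_Ici_le_mul_Ico hw ht h).trans ?_)
    gcongr
    intro s hs
    exact ⟨ht.trans_le hs.1, by linarith [hs.1], hs.2⟩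
  · simp only [low, high, h, if_false, norm_zero]
    simp only [ne_eq, OfNat.ofNat_ne_zero, not_false_eq_true, zero_pow, mul_zero,
      ENNReal.ofReal_zero, zero_mul, add_zero]
    gcongr
    rw [Set.Ioi_inter_Iio]
    refine (setLIntegral_Ioo_le_mul_Ico hw hwt.le (le_of_not_ge h)).trans ?_
    gcongr
    · linarith
    · intro s hs
      have h1 := hs.1
      exact ⟨show (0 : ℝ) < s by linarith, h1, by linarith [hs.2]⟩

/-! ### Areas and the choice of a light annulus -/

lemma areaMeasure_ball {r : ℝ} (hr : 0 ≤ r) :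
    areaMeasure (Metric.ball (0 : ℂ) r) = ENNReal.ofReal (r ^ 2) := by
  rw [areaMeasure, Measure.smul_apply, Complex.volume_ball, smul_eq_mul, ← ENNReal.ofReal_pow hr]
  have : (NNReal.pi : ℝ≥0∞) = ENNReal.ofReal Real.pi := by
    rw [← NNReal.coe_real_pi, ENNReal.ofReal_coe_nnreal]
  rw [this, mul_comm, mul_assoc, ← ENNReal.ofReal_mul Real.pi_pos.le,
    mul_inv_cancel₀ Real.pi_pos.ne', ENNReal.ofReal_one, mul_one]

lemma setOf_norm_sq_mem_Iio (t : ℝ) :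
    {z : ℂ | ‖z‖ ^ 2 ∈ Set.Iio t} = Metric.ball 0 (Real.sqrt t) := by
  ext z
  simp [Real.lt_sqrt (norm_nonneg z)]

lemma areaMeasure_norm_sq_mem_Ico {s t : ℝ} (hs : 0 ≤ s) (hst : s ≤ t) :
    areaMeasure {z : ℂ | ‖z‖ ^ 2 ∈ Set.Ico s t} = ENNReal.ofReal (t - s) := by
  have h : {z : ℂ | ‖z‖ ^ 2 ∈ Set.Ico s t} =
      Metric.ball 0 (Real.sqrt t) \ Metric.ball 0 (Real.sqrt s) := by
    rw [← setOf_norm_sq_mem_Iio, ← setOf_norm_sq_mem_Iio]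
    ext z
    simp [and_comm]
  rw [h, measure_sdiff (Metric.ball_subset_ball (Real.sqrt_le_sqrt hst))
    Metric.isOpen_ball.measurableSet.nullMeasurableSet
    (by rw [areaMeasure_ball (Real.sqrt_nonneg _)]; exact ENNReal.ofReal_ne_top),
    areaMeasure_ball (Real.sqrt_nonneg _), areaMeasure_ball (Real.sqrt_nonneg _),
    Real.sq_sqrt hs, Real.sq_sqrt (hs.trans hst), ENNReal.ofReal_sub _ hs]

/-- Among `N` disjoint concentric annuli in a disk, some annulus carries at most the average
mass. -/
lemma exists_annulus_setLIntegral_le (μ : Measure ℂ) (g : ℂ → ℝ≥0∞) {R w : ℝ} (hR : 0 ≤ R)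
    (hw : 0 ≤ w) {N : ℕ} (hN : 0 < N) :
    ∃ t : ℝ, R ^ 2 - 2 * N * w ≤ t - w ∧ t + w ≤ R ^ 2 ∧
      ∫⁻ z in {z : ℂ | ‖z‖ ^ 2 ∈ Set.Ico (t - w) (t + w)}, g z ∂μ ≤
        (∫⁻ z in Metric.ball 0 R, g z ∂μ) / N := by
  -- Squared radii decreasing from R² in steps of 2w, so all annuli have equal area.
  let u : ℕ → ℝ := fun j => R ^ 2 - 2 * j * w
  have hu : Antitone u := by
    intro i j hij
    have : (i : ℝ) * w ≤ j * w := mul_le_mul_of_nonneg_right (by exact_mod_cast hij) hw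
    simp only [u]
    linarith
  let A : ℕ → Set ℂ := fun j => {z | ‖z‖ ^ 2 ∈ Set.Ico (u (j + 1)) (u j)}
  have hdisj : Set.PairwiseDisjoint (↑(Finset.range N)) A := by
    intro i _ j _ hij
    exact (hu.pairwise_disjoint_on_Ico_succ hij).preimage fun z : ℂ => ‖z‖ ^ 2
  have hsub : (⋃ j ∈ Finset.range N, A j) ⊆ Metric.ball 0 R := by
    refine Set.iUnion₂_subset fun j _ z hz => ?_
    have h1 : ‖z‖ ^ 2 < u j := hz.2
    have h2 : u j ≤ R ^ 2 := by
      have : 0 ≤ 2 * (j : ℝ) * w := by positivity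
      simp only [u]
      linarith
    rw [mem_ball_zero_iff]
    exact lt_of_pow_lt_pow_left₀ 2 hR (h1.trans_le h2)
  have hsum : ∑ j ∈ Finset.range N, ∫⁻ z in A j, g z ∂μ ≤
      ∑ _j ∈ Finset.range N, (∫⁻ z in Metric.ball 0 R, g z ∂μ) / N := by
    rw [← lintegral_biUnion_finset hdisj
      (fun j _ => measurableSet_norm_sq_mem measurableSet_Ico), Finset.sum_const,
      Finset.card_range, nsmul_eq_mul, ENNReal.mul_div_cancel (by exact_mod_cast hN.ne') (by simp)]
    exact lintegral_mono_set hsub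
  obtain ⟨j, hj, hle⟩ : ∃ j ∈ Finset.range N, ∫⁻ z in A j, g z ∂μ ≤
      (∫⁻ z in Metric.ball 0 R, g z ∂μ) / N := by
    by_contra! hlt
    exact (ENNReal.sum_lt_sum_of_nonempty (by simpa using hN.ne') hlt).not_ge hsum
  -- The midpoint of [u (j + 1), u j).
  refine ⟨R ^ 2 - (2 * j + 1) * w, ?_, ?_, ?_⟩
  · have h1 : ((j + 1 : ℕ) : ℝ) ≤ N := by exact_mod_cast Finset.mem_range.1 hj
    have := mul_le_mul_of_nonneg_right h1 hw
    push_cast at this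
    linarith
  · have : 0 ≤ (j : ℝ) * w := by positivity
    linarith
  · have e1 : R ^ 2 - (2 * j + 1) * w - w = u (j + 1) := by
      simp only [u]
      push_cast
      ring
    have e2 : R ^ 2 - (2 * j + 1) * w + w = u j := by
      simp only [u]
      ring
    rw [e1, e2]
    exact hle

/-! ### Pointwise estimates for the discrepancy -/

lemma add_sq_le_weighted (a b : ℝ) {η : ℝ} (hη : 0 < η) :
    (a + b) ^ 2 ≤ (1 + η) * a ^ 2 + (1 + 1 / η) * b ^ 2 := by
  have h : (1 + η) * a ^ 2 + (1 + 1 / η) * b ^ 2 - (a + b) ^ 2 = (η * a - b) ^ 2 / η := by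
    field_simp
    ring
  have : 0 ≤ (η * a - b) ^ 2 / η := by positivity
  linarith

lemma norm_mul_exp_sq (x : ℂ) (y : ℝ) :
    (‖x‖ * Real.exp (-y ^ 2)) ^ 2 = ‖x‖ ^ 2 * Real.exp (-(2 * y ^ 2)) := by
  rw [mul_pow, ← Real.exp_nat_mul]
  congr 2
  push_cast
  ring

lemma planarDiscrepancy_nonneg (f : ℂ → ℂ) (z : ℂ) (R : ℝ) : 0 ≤ planarDiscrepancy f z R :=
  sq_nonneg _

/-- The reverse triangle inequality bounds the change in modulus. The weight η keeps the coefficient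
of the main term close to 1, at the price of a large factor on the error. -/
lemma planarDiscrepancy_le_add_sub (f g : ℂ → ℂ) (z : ℂ) (R : ℝ) {η : ℝ} (hη : 0 < η) :
    planarDiscrepancy g z R ≤ (1 + η) * planarDiscrepancy f z R +
      (1 + 1 / η) * (‖f z - g z‖ ^ 2 * Real.exp (-(2 * ‖z‖ ^ 2))) := by
  set I := (Metric.ball (0 : ℂ) R).indicator (fun _ => (1 : ℝ)) z with hI
  set E := Real.exp (-‖z‖ ^ 2) with hE
  have h1 : (‖g z‖ * E - ‖f z‖ * E) ^ 2 ≤ (‖f z - g z‖ * E) ^ 2 := by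
    rw [← sub_mul, mul_pow, mul_pow]
    refine mul_le_mul_of_nonneg_right ?_ (by positivity)
    rw [norm_sub_rev, ← sq_abs]
    exact pow_le_pow_left₀ (abs_nonneg _) (abs_norm_sub_norm_le _ _) 2
  have h2 := add_sq_le_weighted (‖f z‖ * E - I) (‖g z‖ * E - ‖f z‖ * E) hη
  have e : ‖f z‖ * E - I + (‖g z‖ * E - ‖f z‖ * E) = ‖g z‖ * E - I := by ring
  rw [e] at h2
  rw [← norm_mul_exp_sq]
  unfold planarDiscrepancy
  have h3 : 0 < 1 + 1 / η := by positivity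
  exact h2.trans (add_le_add_right (mul_le_mul_of_nonneg_left h1 h3.le) _)

/-- Comparison with the zero function, whose discrepancy is the indicator itself; used where `F` is
small. -/
lemma planarDiscrepancy_le_indicator_add (g : ℂ → ℂ) (z : ℂ) (R : ℝ) {η : ℝ} (hη : 0 < η) :
    planarDiscrepancy g z R ≤ (1 + η) * (Metric.ball (0 : ℂ) R).indicator (fun _ => (1 : ℝ)) z +
      (1 + 1 / η) * (‖g z‖ ^ 2 * Real.exp (-(2 * ‖z‖ ^ 2))) := by
  have h := planarDiscrepancy_le_add_sub 0 g z R hη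
  have e : planarDiscrepancy 0 z R =
      (Metric.ball (0 : ℂ) R).indicator (fun _ => (1 : ℝ)) z := by
    by_cases hz : z ∈ Metric.ball (0 : ℂ) R <;> simp [planarDiscrepancy, Set.indicator, hz]
  simpa [e] using h

lemma norm_sq_mul_exp_le (g : ℂ → ℂ) {z : ℂ} {R : ℝ} (hz : z ∈ Metric.ball (0 : ℂ) R) :
    ‖g z‖ ^ 2 * Real.exp (-(2 * ‖z‖ ^ 2)) ≤ 2 * planarDiscrepancy g z R + 2 := by
  rw [← norm_mul_exp_sq]
  simp only [planarDiscrepancy, Set.indicator_of_mem hz]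
  -- 2(x - 1)² + 2 - x² = (x - 2)².
  nlinarith [sq_nonneg (‖g z‖ * Real.exp (-‖z‖ ^ 2) - 2)]

lemma measurable_planarDiscrepancy (f : Polynomial ℂ) (R : ℝ) :
    Measurable fun z => planarDiscrepancy (fun w => f.eval w) z R := by
  unfold planarDiscrepancy
  have h1 : Continuous fun z : ℂ => ‖f.eval z‖ * Real.exp (-‖z‖ ^ 2) := by
    have := f.continuous
    fun_prop
  exact (h1.measurable.sub
    (measurable_const.indicator Metric.isOpen_ball.measurableSet)).pow_const 2

lemma setLIntegral_norm_sq_mul_exp_le (f : Polynomial ℂ) (R : ℝ) :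
    ∫⁻ z in Metric.ball 0 R, ENNReal.ofReal (‖f.eval z‖ ^ 2 * Real.exp (-(2 * ‖z‖ ^ 2)))
        ∂areaMeasure ≤
      2 * ∫⁻ z in Metric.ball 0 R,
          ENNReal.ofReal (planarDiscrepancy (fun w => f.eval w) z R) ∂areaMeasure +
        2 * areaMeasure (Metric.ball 0 R) := by
  have hm := (measurable_planarDiscrepancy f R).ennreal_ofReal
  calc _ ≤ ∫⁻ z in Metric.ball 0 R, (2 *
        ENNReal.ofReal (planarDiscrepancy (fun w => f.eval w) z R) + 2) ∂areaMeasure := by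
        refine setLIntegral_mono' Metric.isOpen_ball.measurableSet fun z hz => ?_
        refine (ENNReal.ofReal_le_ofReal (norm_sq_mul_exp_le (fun w => f.eval w) hz)).trans ?_
        rw [ENNReal.ofReal_add (mul_nonneg zero_le_two (planarDiscrepancy_nonneg _ _ _)) zero_le_two,
          ENNReal.ofReal_mul zero_le_two]
        simp
    _ = _ := by
        rw [lintegral_add_right _ measurable_const, lintegral_const_mul _ hm, setLIntegral_const]

/-! ### From the disk to the plane -/

/-- Extending a polynomial on a disk to a polynomial which is small outside that disk. -/
lemma exists_lintegral_planarDiscrepancy_le (f : Polynomial ℂ) {R t w η : ℝ} (hR : 0 ≤ R)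
    (hw : 0 < w) (hwt : w < t) (htR : t ≤ R ^ 2) (hη : 0 < η) :
    ∃ F : Polynomial ℂ,
      ∫⁻ z, ENNReal.ofReal (planarDiscrepancy (fun w => F.eval w) z R) ∂areaMeasure ≤
        ENNReal.ofReal (1 + η) * (∫⁻ z in Metric.ball 0 R,
            ENNReal.ofReal (planarDiscrepancy (fun w => f.eval w) z R) ∂areaMeasure +
          ENNReal.ofReal (R ^ 2 - t)) +
        ENNReal.ofReal (1 + 1 / η) * (ENNReal.ofReal (1 + (t + w) / (2 * w ^ 2)) *
          ∫⁻ z in {z : ℂ | ‖z‖ ^ 2 ∈ Set.Ico (t - w) (t + w)},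
            ENNReal.ofReal (‖f.eval z‖ ^ 2 * Real.exp (-(2 * ‖z‖ ^ 2))) ∂areaMeasure) := by
  have ht : 0 < t := hw.trans hwt
  obtain ⟨F, hF⟩ := exists_polynomial_approx_restrict f hw hwt
  refine ⟨F, ?_⟩
  have hF' : ∫⁻ z in {z : ℂ | ‖z‖ ^ 2 ∈ Set.Iio t},
          ENNReal.ofReal (‖f.eval z - F.eval z‖ ^ 2 * Real.exp (-(2 * ‖z‖ ^ 2))) ∂areaMeasure +
        ∫⁻ z in {z : ℂ | ‖z‖ ^ 2 ∈ Set.Ici t},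
          ENNReal.ofReal (‖F.eval z‖ ^ 2 * Real.exp (-(2 * ‖z‖ ^ 2))) ∂areaMeasure ≤
      ENNReal.ofReal (1 + (t + w) / (2 * w ^ 2)) *
        ∫⁻ z in {z : ℂ | ‖z‖ ^ 2 ∈ Set.Ico (t - w) (t + w)},
          ENNReal.ofReal (‖f.eval z‖ ^ 2 * Real.exp (-(2 * ‖z‖ ^ 2))) ∂areaMeasure := by
    simp only [areaMeasure, Measure.restrict_smul, lintegral_smul_measure, smul_eq_mul]
    rw [← mul_add, mul_left_comm]
    exact mul_le_mul_right hF _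
  have hfc := f.continuous
  have hFc := F.continuous
  have hm := (measurable_planarDiscrepancy f R).ennreal_ofReal
  have hball : MeasurableSet (Metric.ball (0 : ℂ) R) := Metric.isOpen_ball.measurableSet
  have hin : {z : ℂ | ‖z‖ ^ 2 ∈ Set.Iio t} ⊆ Metric.ball 0 R := by
    rw [setOf_norm_sq_mem_Iio]
    exact Metric.ball_subset_ball ((Real.sqrt_le_left hR).2 htR)
  have hcompl : {z : ℂ | ‖z‖ ^ 2 ∈ Set.Iio t}ᶜ = {z : ℂ | ‖z‖ ^ 2 ∈ Set.Ici t} := by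
    ext z
    simp
  -- Inside |z|² < t, `F` is compared with `f`.
  have hinner : ∫⁻ z in {z : ℂ | ‖z‖ ^ 2 ∈ Set.Iio t},
      ENNReal.ofReal (planarDiscrepancy (fun w => F.eval w) z R) ∂areaMeasure ≤
      ENNReal.ofReal (1 + η) * ∫⁻ z in Metric.ball 0 R,
            ENNReal.ofReal (planarDiscrepancy (fun w => f.eval w) z R) ∂areaMeasure +
        ENNReal.ofReal (1 + 1 / η) * ∫⁻ z in {z : ℂ | ‖z‖ ^ 2 ∈ Set.Iio t},
          ENNReal.ofReal (‖f.eval z - F.eval z‖ ^ 2 * Real.exp (-(2 * ‖z‖ ^ 2))) ∂areaMeasure := by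
    calc _ ≤ ∫⁻ z in {z : ℂ | ‖z‖ ^ 2 ∈ Set.Iio t}, (ENNReal.ofReal (1 + η) *
            ENNReal.ofReal (planarDiscrepancy (fun w => f.eval w) z R) +
          ENNReal.ofReal (1 + 1 / η) * ENNReal.ofReal
            (‖f.eval z - F.eval z‖ ^ 2 * Real.exp (-(2 * ‖z‖ ^ 2)))) ∂areaMeasure := by
          refine lintegral_mono fun z => ?_
          refine (ENNReal.ofReal_le_ofReal (planarDiscrepancy_le_add_sub (fun w => f.eval w)
            (fun w => F.eval w) z R hη)).trans ?_
          rw [← ENNReal.ofReal_mul (by positivity), ← ENNReal.ofReal_mul (by positivity),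
            ← ENNReal.ofReal_add (mul_nonneg (by positivity) (planarDiscrepancy_nonneg _ _ _)) (by positivity)]
      _ ≤ _ := by
          rw [lintegral_add_left (hm.const_mul _), lintegral_const_mul _ hm,
            lintegral_const_mul _ (by fun_prop)]
          gcongr
  -- Outside, `F` is compared with 0; the indicator survives only on t ≤ |z|² < R², of area R² - t.
  have houter : ∫⁻ z in {z : ℂ | ‖z‖ ^ 2 ∈ Set.Ici t},
      ENNReal.ofReal (planarDiscrepancy (fun w => F.eval w) z R) ∂areaMeasure ≤
      ENNReal.ofReal (1 + η) * ENNReal.ofReal (R ^ 2 - t) +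
        ENNReal.ofReal (1 + 1 / η) * ∫⁻ z in {z : ℂ | ‖z‖ ^ 2 ∈ Set.Ici t},
          ENNReal.ofReal (‖F.eval z‖ ^ 2 * Real.exp (-(2 * ‖z‖ ^ 2))) ∂areaMeasure := by
    calc _ ≤ ∫⁻ z in {z : ℂ | ‖z‖ ^ 2 ∈ Set.Ici t}, (ENNReal.ofReal (1 + η) *
            (Metric.ball (0 : ℂ) R).indicator 1 z +
          ENNReal.ofReal (1 + 1 / η) * ENNReal.ofReal
            (‖F.eval z‖ ^ 2 * Real.exp (-(2 * ‖z‖ ^ 2)))) ∂areaMeasure := by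
          refine lintegral_mono fun z => ?_
          refine (ENNReal.ofReal_le_ofReal (planarDiscrepancy_le_indicator_add
            (fun w => F.eval w) z R hη)).trans ?_
          have h1 : (Metric.ball (0 : ℂ) R).indicator (1 : ℂ → ℝ≥0∞) z = ENNReal.ofReal
              ((Metric.ball (0 : ℂ) R).indicator (fun _ => (1 : ℝ)) z) := by
            by_cases hz : z ∈ Metric.ball (0 : ℂ) R <;> simp [Set.indicator, hz]
          have h2 : 0 ≤ (Metric.ball (0 : ℂ) R).indicator (fun _ => (1 : ℝ)) z :=
            Set.indicator_nonneg (fun _ _ => zero_le_one) z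
          rw [h1, ← ENNReal.ofReal_mul (by positivity), ← ENNReal.ofReal_mul (by positivity),
            ← ENNReal.ofReal_add (mul_nonneg (by positivity) h2) (by positivity)]
      _ = _ := by
          have hset : {z : ℂ | ‖z‖ ^ 2 ∈ Set.Ici t} ∩ Metric.ball 0 R =
              {z : ℂ | ‖z‖ ^ 2 ∈ Set.Ico t (R ^ 2)} := by
            ext z
            simp [pow_lt_pow_iff_left₀ (norm_nonneg z) hR two_ne_zero]
          rw [lintegral_add_left ((measurable_one.indicator hball).const_mul _),
            lintegral_const_mul _ (measurable_one.indicator hball),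
            lintegral_const_mul _ (by fun_prop), lintegral_indicator_one hball,
            Measure.restrict_apply hball, Set.inter_comm, hset,
            areaMeasure_norm_sq_mem_Ico ht.le htR]
  rw [← lintegral_add_compl _ (measurableSet_norm_sq_mem (measurableSet_Iio (a := t))), hcompl]
  refine (add_le_add hinner houter).trans ?_
  rw [add_add_add_comm, ← mul_add, ← mul_add]
  gcongr

/-- The parameters are η = 1/k and k² annuli. The factor 1 + 1/η = 1 + k multiplies a window mass of
order R²/k², leaving an error of order R²/k. -/
lemma exists_tightPlanarFunctional_le {k : ℕ} (hk : 2 ≤ k) {R : ℝ} (hR : 0 < R)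
    (hkR : 2 * (k : ℝ) ^ 8 ≤ R ^ 2) (f : Polynomial ℂ) (hf : planarFunctional R f ≤ 1) :
    ∃ F : Polynomial ℂ,
      tightPlanarFunctional R F ≤ planarFunctional R f + ENNReal.ofReal (19 / k) := by
  have hk2 : (2 : ℝ) ≤ k := by exact_mod_cast hk
  have hk0 : (0 : ℝ) < k := by linarith
  set B := areaMeasure (Metric.ball (0 : ℂ) R) with hB
  have hBR : B = ENNReal.ofReal (R ^ 2) := areaMeasure_ball hR.le
  have hB0 : B ≠ 0 := by
    rw [hBR]
    exact (ENNReal.ofReal_pos.2 (by positivity)).ne'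
  have hBtop : B ≠ ∞ := by
    rw [hBR]
    exact ENNReal.ofReal_ne_top
  set P := ∫⁻ z in Metric.ball (0 : ℂ) R,
      ENNReal.ofReal (planarDiscrepancy (fun w => f.eval w) z R) ∂areaMeasure with hP
  have hPf : planarFunctional R f = P / B := rfl
  have hPB : P ≤ B := by
    rw [hPf, ENNReal.div_le_iff hB0 hBtop, one_mul] at hf
    exact hf
  set N := k ^ 2 with hN
  have hN0 : 0 < N := by positivity
  have hNk : (N : ℝ) = k ^ 2 := by simp [hN]
  -- With this w the k² annuli use up a total area of R²/k², and 2w² = R⁴ / (2k⁸) ≥ R² by `hkR`, so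
  -- the tail constant is at most 2.
  set w := R ^ 2 / (2 * (k : ℝ) ^ 4) with hw
  have hw0 : 0 < w := by positivity
  obtain ⟨t, ht1, ht2, hmass⟩ := exists_annulus_setLIntegral_le areaMeasure
    (fun z => ENNReal.ofReal (‖f.eval z‖ ^ 2 * Real.exp (-(2 * ‖z‖ ^ 2)))) hR.le hw0.le hN0
  have hNw : 2 * (N : ℝ) * w = R ^ 2 / k ^ 2 := by
    rw [hNk, hw]
    field_simp
  rw [hNw] at ht1
  -- Together with `ht1` this yields w < t.
  have hlt : R ^ 2 / (k : ℝ) ^ 2 < R ^ 2 := by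
    rw [div_lt_iff₀ (by positivity)]
    have : (1 : ℝ) < (k : ℝ) ^ 2 := by nlinarith
    nlinarith [pow_pos hR 2]
  obtain ⟨p, hp0, hp⟩ : ∃ p : ℝ, 0 ≤ p ∧ P = ENNReal.ofReal p :=
    ⟨P.toReal, ENNReal.toReal_nonneg,
      (ENNReal.ofReal_toReal (ne_top_of_le_ne_top hBtop hPB)).symm⟩
  have hpR : p ≤ R ^ 2 := by
    rw [hp, hBR] at hPB
    exact (ENNReal.ofReal_le_ofReal_iff (by positivity)).1 hPB
  have hmass' : ∫⁻ z in {z : ℂ | ‖z‖ ^ 2 ∈ Set.Ico (t - w) (t + w)},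
      ENNReal.ofReal (‖f.eval z‖ ^ 2 * Real.exp (-(2 * ‖z‖ ^ 2))) ∂areaMeasure ≤
      ENNReal.ofReal (4 * R ^ 2 / k ^ 2) := by
    refine hmass.trans ?_
    rw [ENNReal.ofReal_div_of_pos (by positivity)]
    have h1 : ENNReal.ofReal ((k : ℝ) ^ 2) = (N : ℝ≥0∞) := by
      rw [← hNk, ENNReal.ofReal_natCast]
    rw [h1]
    gcongr
    refine (setLIntegral_norm_sq_mul_exp_le f R).trans ?_
    calc 2 * P + 2 * B ≤ 2 * B + 2 * B := by gcongr
      _ = ENNReal.ofReal (4 * R ^ 2) := by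
        rw [hBR, ENNReal.ofReal_mul (by norm_num), ← add_mul]
        congr 1
        norm_num
  have hC : 1 + (t + w) / (2 * w ^ 2) ≤ 2 := by
    have h2 : (t + w) / (2 * w ^ 2) ≤ 1 := by
      rw [div_le_one (by positivity)]
      refine ht2.trans ?_
      have h3 : 2 * w ^ 2 = R ^ 2 * (R ^ 2 / (2 * (k : ℝ) ^ 8)) := by
        rw [hw]
        field_simp
      rw [h3]
      have h4 : 1 ≤ R ^ 2 / (2 * (k : ℝ) ^ 8) := by
        rw [le_div_iff₀ (by positivity)]
        linarith
      nlinarith [pow_pos hR 2]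
    linarith
  obtain ⟨F, hF⟩ := exists_lintegral_planarDiscrepancy_le f hR.le hw0 (by linarith : w < t)
    (by linarith : t ≤ R ^ 2) (by positivity : 0 < 1 / (k : ℝ))
  refine ⟨F, ?_⟩
  have hfinal : ∫⁻ z, ENNReal.ofReal (planarDiscrepancy (fun w => F.eval w) z R) ∂areaMeasure ≤
      P + ENNReal.ofReal (19 / k) * B := by
    refine hF.trans ?_
    calc _ ≤ ENNReal.ofReal (1 + 1 / k) * (ENNReal.ofReal p + ENNReal.ofReal (R ^ 2 / k ^ 2)) +
          ENNReal.ofReal (1 + 1 / (1 / k)) * (ENNReal.ofReal 2 *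
            ENNReal.ofReal (4 * R ^ 2 / k ^ 2)) := by
          rw [← hP, hp]
          gcongr
          linarith
      _ = ENNReal.ofReal ((1 + 1 / k) * (p + R ^ 2 / k ^ 2) +
            (1 + 1 / (1 / k)) * (2 * (4 * R ^ 2 / k ^ 2))) := by
          rw [← ENNReal.ofReal_mul zero_le_two, ← ENNReal.ofReal_mul (by positivity),
            ← ENNReal.ofReal_add hp0 (by positivity), ← ENNReal.ofReal_mul (by positivity),
            ← ENNReal.ofReal_add (by positivity) (by positivity)]
      _ ≤ ENNReal.ofReal (p + 19 / k * R ^ 2) := by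
          refine ENNReal.ofReal_le_ofReal ?_
          set x : ℝ := 1 / k with hx
          have hx0 : 0 < x := by positivity
          have hx2 : x ≤ 1 / 2 := one_div_le_one_div_of_le zero_lt_two hk2
          have e1 : (1 + x) * (p + R ^ 2 / k ^ 2) + (1 + 1 / x) * (2 * (4 * R ^ 2 / k ^ 2)) =
              p + x * p + x * R ^ 2 * ((1 + x) * x + (x + 1) * 8) := by
            rw [hx]
            field_simp
            ring
          have e2 : (19 : ℝ) / k * R ^ 2 = x * R ^ 2 * 19 := by
            rw [hx]
            ring
          rw [e1, e2]
          have h5 : x * p ≤ x * R ^ 2 := mul_le_mul_of_nonneg_left hpR hx0.le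
          -- 18 is the value at x = 1; the term x p ≤ x R² raises the constant to 19.
          have h6 : (1 + x) * x + (x + 1) * 8 ≤ 18 := by nlinarith
          have h7 := mul_le_mul_of_nonneg_left h6 (by positivity : 0 ≤ x * R ^ 2)
          linarith
      _ = P + ENNReal.ofReal (19 / k) * B := by
          rw [hp, hBR, ENNReal.ofReal_add hp0 (by positivity), ENNReal.ofReal_mul (by positivity)]
  rw [hPf]
  unfold tightPlanarFunctional
  rw [← hB, ENNReal.div_le_iff hB0 hBtop, add_mul, ENNReal.div_mul_cancel hB0 hBtop]
  exact hfinal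

/-! ### Comparison of the densities -/

lemma eventually_iInf_tightPlanarFunctional_le {k : ℕ} (hk : 2 ≤ k) :
    ∀ᶠ R : ℝ in atTop, ⨅ f : Polynomial ℂ, tightPlanarFunctional R f ≤
      (⨅ f : Polynomial ℂ, planarFunctional R f) + ENNReal.ofReal (19 / k) := by
  filter_upwards [eventually_gt_atTop 0,
    (tendsto_pow_atTop two_ne_zero).eventually_ge_atTop (2 * (k : ℝ) ^ 8)] with R hR hkR
  rw [ENNReal.iInf_add]
  refine le_iInf fun f => ?_
  rcases le_total (planarFunctional R f) 1 with hf | hf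
  · obtain ⟨F, hF⟩ := exists_tightPlanarFunctional_le hk hR hkR f hf
    exact (iInf_le _ F).trans hF
  -- If `f` does no better than 1, the zero polynomial already suffices.
  · exact (iInf_le _ 0).trans ((tightPlanarFunctional_zero_le_one R).trans
      (hf.trans le_self_add))

lemma tightPlanarDensity_le_add {k : ℕ} (hk : 2 ≤ k) :
    tightPlanarDensity ≤ planarDensity + ENNReal.ofReal (19 / k) := by
  unfold tightPlanarDensity planarDensity
  refine (liminf_le_liminf (eventually_iInf_tightPlanarFunctional_le hk)).trans ?_
  -- Adding a constant is monotone and continuous, hence commutes with `liminf`.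
  have h := Monotone.map_liminf_of_continuousAt (F := (atTop : Filter ℝ))
    (f := fun x : ℝ≥0∞ => x + ENNReal.ofReal (19 / k)) (fun x y hxy => add_le_add_left hxy _)
    (fun R : ℝ => ⨅ f : Polynomial ℂ, planarFunctional R f)
    (by fun_prop)
  exact h.ge

/-- The planar discrepancy density and the tight planar discrepancy density coincide. -/
theorem theorem1p4 : planarDensity = tightPlanarDensity := by
  refine le_antisymm planarDensity_le_tight ?_
  have hlim : Tendsto (fun k : ℕ => planarDensity + ENNReal.ofReal (19 / k)) atTop
      (nhds (planarDensity + ENNReal.ofReal 0)) :=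
    (ENNReal.tendsto_ofReal (tendsto_const_div_atTop_nhds_zero_nat 19)).const_add _
  rw [ENNReal.ofReal_zero, add_zero] at hlim
  exact ge_of_tendsto hlim ((eventually_ge_atTop 2).mono fun k hk => tightPlanarDensity_le_add hk)
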